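/- Let $T>0$ and let $\{\Omega(t)\}_{t\in\mathbb R}$ be a family of bounded domains in $\mathbb R^3$ with $C^\infty$ boundary such that: (i) there are a domain $\widetilde\Omega\subset\mathbb R^3$ and a level-preserving $C^\infty$ diffeomorphism $\Phi(x,t)=(\phi(x,t),t)$ from $\overline{Q_\infty}$ onto $\overline{\widetilde\Omega\times\mathbb R}$, where $Q_\infty=\bigcup_{t}\Omega(t)\times\{t\}$, with $\phi(\Omega(t),t)=\widetilde\Omega$ and with $\det(\partial\phi^i/\partial x^j)(x,t)=J(t)^{-1}>0$ depending on $t$ only; $\phi^{-1}(\cdot,t)$ denotes the inverse of $\phi(\cdot,t)$; (ii) there is $K\in\mathbb N\cup\{0\}$ such that, for every $t$, $\partial\Omega(t)$ has exactly $K+1$ connected components $\Gamma_0(t),\dots,\Gamma_K(t)$, where $\Gamma_1(t),\dots,\Gamma_K(t)$ lie inside $\Gamma_0(t)$; and there is $L\in\mathbb N\cup\{0\}$ such that, for every $t$, $\Omega(t)$ becomes simply connected after removing $L$ mutually disjoint $C^\infty$ surfaces transversal to $\partial\Omega(t)$. Assume $\phi^{-1}(\cdot,t+T)=\phi^{-1}(\cdot,t)$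 for all $t$, and $\Omega(t)=\lambda(t)\Omega(0)=\{\lambda(t)x: x\in\Omega(0)\}$ with $\lambda\in C^\infty(\mathbb R)$, $\lambda(t)>0$, $\lambda(t+T)=\lambda(t)$ for all $t\in\mathbb R$. Let $\nu(t)$ be the outward unit normal to $\partial\Omega(t)$, and let $\beta(t)\in H^{1/2}(\partial\Omega(t))$ be vector fields with $\int_{\partial\Omega(t)}\beta(t)\cdot\nu(t)\,dS=0$ and $\beta(t+T)=\beta(t)$ for all $t\in\mathbb R$, such that $\widetilde\beta\in C^1(\mathbb R;H^{1/2}(\partial\widetilde\Omega))$, where $$\widetilde\beta^{\,i}(y,t)=\sum_{\ell}\frac{\partial\phi^i}{\partial x^\ell}(\phi^{-1}(y,t),t)\,\beta^\ell(\phi^{-1}(y,t),t).$$ For $k=1,\dots,K$ let $q_k(t)\in C^\infty(\overline{\Omega(t)})$ be the solution of $\Delta q_k(t)=0$ in $\Omega(t)$, $q_k(t)=\delta_{kj}$ on $\Gamma_j(t)$, $j=0,\dots,K$. Let $\eta_1(t),\dots,\eta_K(t)$ be obtained from $\nabla q_1(t),\dots,\nabla q_K(t)$ by the Gram–Schmidt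 orthonormalization in $L^2(\Omega(t))$, and write $\eta_j(t)=\sum_{k=1}^K\alpha_{jk}(t)\nabla q_k(t)$, with $\alpha_{jk}(t)=0$ for $k>j$. Let $C_s=3^{-1/2}2^{2/3}\pi^{-2/3}$. Then there is a constant $C_0>0$, depending only on $\Omega(0)$, such that if $$\frac1{\lambda(t)}\sum_{k=1}^K\left|\int_{\Gamma_k(t)}\beta(t)\cdot\nu(t)\,dS\right|<C_0\qquad\text{for all }t\in[0,T],$$ then $$\sup_{0\le t\le T}\left\|\sum_{\ell,k=1}^K\alpha_{k\ell}(t)\left(\int_{\Gamma_\ell(t)}\beta(t)\cdot\nu(t)\,dS\right)\eta_k(t)\right\|_{L^3(\Omega(t))}<\frac1{C_s},$$ which is the smallness hypothesis of the existence theorem for time-periodic solutions of the Navier–Stokes equations on $\Omega(t)$. -/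

import Mathlib

open Set Filter Topology MeasureTheory
open scoped ContDiff Gradient Laplacian

noncomputable section

/-- Three-dimensional Euclidean space. -/
abbrev E3 : Type := EuclideanSpace ℝ (Fin 3)

/-! ### Bounded domains with smooth boundary -/

/-- `ρ` is a smooth local defining function of `Ω` on the open set `U`. -/
structure IsLocalDefiningFunction (Ω U : Set E3) (ρ : E3 → ℝ) : Prop where
  isOpen : IsOpen U
  smooth : ContDiffOn ℝ ∞ ρ U
  gradient_ne_zero : ∀ y ∈ U, ∇ ρ y ≠ 0
  inter_eq : Ω ∩ U = {y | ρ y < 0} ∩ U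

/-- A bounded domain (nonempty connected open set) of `ℝ³` with `C^∞` boundary. -/
structure IsSmoothBoundedDomain (Ω : Set E3) : Prop where
  isOpen : IsOpen Ω
  isConnected : IsConnected Ω
  isBounded : Bornology.IsBounded Ω
  smooth_boundary : ∀ x ∈ frontier Ω, ∃ U : Set E3, ∃ ρ : E3 → ℝ,
    x ∈ U ∧ IsLocalDefiningFunction Ω U ρ

/-- `n` is the outward unit normal vector to `∂Ω` at `x`. -/
def IsOutwardUnitNormal (Ω : Set E3) (x n : E3) : Prop :=
  ∃ U : Set E3, ∃ ρ : E3 → ℝ, x ∈ U ∧ IsLocalDefiningFunction Ω U ρ ∧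
    n = ‖∇ ρ x‖⁻¹ • ∇ ρ x

/-- The outward unit normal vector field `ν` on `∂Ω`. -/
def outwardNormal (Ω : Set E3) (x : E3) : E3 :=
  Classical.epsilon (IsOutwardUnitNormal Ω x)

/-- The surface measure `dS`: the two-dimensional Hausdorff measure, normalized so that it agrees
with the Lebesgue measure on planes. -/
abbrev surfaceMeasure : Measure E3 := μHE[2]

/-- The flux `∫_S b · ν dS` through a part `S` of `∂Ω`. -/
def flux (Ω S : Set E3) (b : E3 → E3) : ℝ :=
  ∫ x in S, inner ℝ (b x) (outwardNormal Ω x) ∂surfaceMeasure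

/-- `Γ 0, …, Γ K` are the connected components of `∂Ω` (pairwise disjoint closed connected sets
with union `∂Ω`), and `Γ 1, …, Γ K` lie inside `Γ 0`, i.e. in bounded components of its
complement. -/
structure IsBoundaryLabelling {K : ℕ} (Ω : Set E3) (Γ : Fin (K + 1) → Set E3) : Prop where
  isClosed : ∀ k, IsClosed (Γ k)
  isConnected : ∀ k, IsConnected (Γ k)
  disjoint : ∀ k l, k ≠ l → Disjoint (Γ k) (Γ l)
  iUnion_eq : ⋃ k, Γ k = frontier Ω
  inside : ∀ k, k ≠ 0 → ∀ x ∈ Γ k, Bornology.IsBounded (connectedComponentIn (Γ 0)ᶜ x)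

/-- `S` is a `C^∞` surface in `closure Ω` which meets `∂Ω` transversally (along its own
boundary). -/
structure IsTransversalSurface (Ω S : Set E3) : Prop where
  isClosed : IsClosed S
  subset : S ⊆ closure Ω
  smooth : ∀ x ∈ S, ∃ U : Set E3, ∃ σ : E3 → ℝ, IsOpen U ∧ x ∈ U ∧ ContDiffOn ℝ ∞ σ U ∧
    (∀ y ∈ U, ∇ σ y ≠ 0) ∧ S ∩ U = {y | σ y = 0} ∩ closure Ω ∩ U ∧
    (x ∈ frontier Ω → LinearIndependent ℝ ![∇ σ x, outwardNormal Ω x])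

/-- Cutting `Ω` along the disjoint transversal surfaces `S 1, …, S L` leaves a simply connected
domain. -/
structure IsCutSystem {L : ℕ} (Ω : Set E3) (S : Fin L → Set E3) : Prop where
  surface : ∀ l, IsTransversalSurface Ω (S l)
  disjoint : ∀ l m, l ≠ m → Disjoint (S l) (S m)
  simplyConnected : IsSimplyConnected (Ω \ ⋃ l, S l)

/-! ### The time dependent domain -/

/-- The noncylindrical space-time domain `⋃ₜ Ω(t) × {t}`. -/
def spaceTime (Ω : ℝ → Set E3) : Set (E3 × ℝ) := {p | p.1 ∈ Ω p.2}

/-- The spatial Jacobian matrix `∂φ/∂x (x, t)` on `closure Ω(t)`, as a linear map. -/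
def spatialDeriv (Ω : ℝ → Set E3) (φ : E3 × ℝ → E3) (x : E3) (t : ℝ) : E3 →L[ℝ] E3 :=
  fderivWithin ℝ (fun z => φ (z, t)) (closure (Ω t)) x

/-- `(x, t) ↦ (φ (x, t), t)` is a level-preserving `C^∞` diffeomorphism of the closure of
`⋃ₜ Ω(t) × {t}` onto the closure of the cylinder `Ω' × ℝ`, with inverse `(y, s) ↦ (ψ (y, s), s)`,
and its spatial Jacobian determinant is positive and depends on time only. -/
structure IsLevelDiffeo (Ω : ℝ → Set E3) (Ω' : Set E3) (φ ψ : E3 × ℝ → E3) : Prop where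
  isOpen : IsOpen Ω'
  isConnected : IsConnected Ω'
  smooth : ContDiffOn ℝ ∞ φ (closure (spaceTime Ω))
  smooth_inv : ContDiffOn ℝ ∞ ψ (closure (Ω' ×ˢ univ))
  mapsTo : ∀ p ∈ closure (spaceTime Ω), (φ p, p.2) ∈ closure (Ω' ×ˢ (univ : Set ℝ))
  mapsTo_inv : ∀ p ∈ closure (Ω' ×ˢ (univ : Set ℝ)), (ψ p, p.2) ∈ closure (spaceTime Ω)
  left_inv : ∀ p ∈ closure (spaceTime Ω), ψ (φ p, p.2) = p.1
  right_inv : ∀ p ∈ closure (Ω' ×ˢ (univ : Set ℝ)), φ (ψ p, p.2) = p.1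
  image_eq : ∀ t, (fun x => φ (x, t)) '' Ω t = Ω'
  jacobian : ∃ J : ℝ → ℝ, ∀ t, 0 < J t ∧
    ∀ x ∈ closure (Ω t), (spatialDeriv Ω φ x t).det = (J t)⁻¹

/-- The standing assumption on the family `Ω(t)`, with boundary components
`Γ_0(t), …, Γ_K(t)`, reference domain `Ω'` and diffeomorphism `φ` with inverse `ψ`. -/
structure IsAdmissibleFamily {K : ℕ} (Ω : ℝ → Set E3) (Γ : ℝ → Fin (K + 1) → Set E3)
    (Ω' : Set E3) (φ ψ : E3 × ℝ → E3) : Prop where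
  domain : ∀ t, IsSmoothBoundedDomain (Ω t)
  diffeo : IsLevelDiffeo Ω Ω' φ ψ
  boundary : ∀ t, IsBoundaryLabelling (Ω t) (Γ t)
  cuts : ∃ L : ℕ, ∀ t, ∃ S : Fin L → Set E3, IsCutSystem (Ω t) S

/-- The transform `b̃ⁱ(y, t) = ∑ₗ ∂φⁱ/∂xˡ(ψ(y, t), t) bˡ(ψ(y, t), t)` of a time dependent vector
field. -/
def transformField (Ω : ℝ → Set E3) (φ ψ : E3 × ℝ → E3) (b : ℝ → E3 → E3) :
    ℝ → E3 → E3 :=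
  fun t y => spatialDeriv Ω φ (ψ (y, t)) t (b t (ψ (y, t)))

/-! ### The space `H^{1/2}` of vector fields on a closed surface -/

/-- The squared Sobolev-Slobodeckij norm of `H^{1/2}(S)`, for a surface `S`. -/
def hHalfNormSq (S : Set E3) (f : E3 → E3) : ENNReal :=
  (∫⁻ x in S, ‖f x‖ₑ ^ 2 ∂surfaceMeasure) +
    ∫⁻ x in S, ∫⁻ y in S, ‖f x - f y‖ₑ ^ 2 / ‖x - y‖ₑ ^ 3 ∂surfaceMeasure ∂surfaceMeasure

/-- `f ∈ H^{1/2}(S)`. -/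
def MemHHalf (S : Set E3) (f : E3 → E3) : Prop :=
  AEStronglyMeasurable f (surfaceMeasure.restrict S) ∧ hHalfNormSq S f < ⊤

/-- `f ∈ C¹(ℝ; H^{1/2}(S))`. -/
def IsC1HHalf (S : Set E3) (f : ℝ → E3 → E3) : Prop :=
  (∀ t, MemHHalf S (f t)) ∧ ∃ g : ℝ → E3 → E3, (∀ t, MemHHalf S (g t)) ∧
    (∀ t, Tendsto (fun h : ℝ => hHalfNormSq S (h⁻¹ • (f (t + h) - f t) - g t))
      (𝓝[≠] 0) (𝓝 0)) ∧
    ∀ t, Tendsto (fun s : ℝ => hHalfNormSq S (g s - g t)) (𝓝 t) (𝓝 0)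

/-! ### Harmonic vector fields and the smallness condition -/

/-- `q ∈ C^∞(closure Ω)` solves `Δ q = 0` in `Ω`, `q = 1` on `Γ_k`, `q = 0` on the other boundary
components. Here `k : Fin K` stands for the index `k + 1 ∈ {1, …, K}`. -/
structure IsHarmonicPotential {K : ℕ} (Ω : Set E3) (Γ : Fin (K + 1) → Set E3) (k : Fin K)
    (q : E3 → ℝ) : Prop where
  smooth : ContDiffOn ℝ ∞ q (closure Ω)
  harmonic : ∀ x ∈ Ω, Δ q x = 0
  boundary : ∀ j, ∀ x ∈ Γ j, q x = if j = k.succ then 1 else 0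

/-- The `L²(Ω)` inner product of vector fields. -/
def l2Inner (Ω : Set E3) (u v : E3 → E3) : ℝ := ∫ x in Ω, inner ℝ (u x) (v x)

/-- The `L²(Ω)` norm of a vector field. -/
def l2Norm (Ω : Set E3) (u : E3 → E3) : ℝ := Real.sqrt (l2Inner Ω u u)

/-- The linear combination `∑ₖ cₖ vₖ` of vector fields. -/
def combination {K : ℕ} (v : Fin K → E3 → E3) (c : Fin K → ℝ) : E3 → E3 := ∑ k, c k • v k

/-- The coefficients `α_{j1}, …, α_{jK}` of the Gram-Schmidt orthonormalization of
`v_1, …, v_K` in `L²(Ω)`. -/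
def gramSchmidtCoeff {K : ℕ} (Ω : Set E3) (v : Fin K → E3 → E3) (j : Fin K) : Fin K → ℝ :=
  let r : Fin K → ℝ := Pi.single j 1 -
    ∑ i : Finset.Iio j, l2Inner Ω (v j) (combination v (gramSchmidtCoeff Ω v i)) •
      gramSchmidtCoeff Ω v i
  (l2Norm Ω (combination v r))⁻¹ • r
termination_by j
decreasing_by exact Fin.lt_def.1 (Finset.mem_Iio.1 i.2)

/-- `α_{jk}`: the Gram-Schmidt coefficients of `∇q_1, …, ∇q_K` in `L²(Ω)`. -/
def alphaCoeff {K : ℕ} (Ω : Set E3) (q : Fin K → E3 → ℝ) (j k : Fin K) : ℝ :=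
  gramSchmidtCoeff Ω (fun l => ∇ (q l)) j k

/-- `η_j = ∑ₖ α_{jk} ∇q_k`: the `L²(Ω)`-orthonormal harmonic vector fields obtained from
`∇q_1, …, ∇q_K` by the Gram-Schmidt procedure. -/
def etaField {K : ℕ} (Ω : Set E3) (q : Fin K → E3 → ℝ) (j : Fin K) : E3 → E3 :=
  ∑ k, alphaCoeff Ω q j k • ∇ (q k)

/-- The recursion of the Gram-Schmidt procedure:
`η_j = (∇q_j - ∑_{i<j} (∇q_j, η_i) η_i) / ‖∇q_j - ∑_{i<j} (∇q_j, η_i) η_i‖`. -/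
theorem etaField_eq {K : ℕ} (Ω : Set E3) (q : Fin K → E3 → ℝ) (j : Fin K) :
    etaField Ω q j =
      (l2Norm Ω (∇ (q j) -
        ∑ i ∈ Finset.Iio j, l2Inner Ω (∇ (q j)) (etaField Ω q i) • etaField Ω q i))⁻¹ •
      (∇ (q j) -
        ∑ i ∈ Finset.Iio j, l2Inner Ω (∇ (q j)) (etaField Ω q i) • etaField Ω q i) := by
  set v : Fin K → E3 → E3 := fun l => ∇ (q l) with hv
  have hη : ∀ i, etaField Ω q i = combination v (gramSchmidtCoeff Ω v i) := fun i => rfl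
  have hsub : ∀ a b : Fin K → ℝ, combination v (a - b) = combination v a - combination v b := by
    intro a b
    simp [combination, sub_smul, Finset.sum_sub_distrib]
  have hsmul : ∀ (c : ℝ) (a : Fin K → ℝ), combination v (c • a) = c • combination v a := by
    intro c a
    simp [combination, Finset.smul_sum, smul_smul]
  have hsum : ∀ (s : Finset (Fin K)) (a : Fin K → Fin K → ℝ),
      combination v (∑ i ∈ s, a i) = ∑ i ∈ s, combination v (a i) := by
    intro s a
    simp only [combination, Finset.sum_apply, Finset.sum_smul]
    exact Finset.sum_comm
  have hsingle : combination v (Pi.single j 1) = v j := by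
    simp [combination, Pi.single_apply]
  have hr : combination v (Pi.single j 1 - ∑ i : Finset.Iio j,
      l2Inner Ω (v j) (combination v (gramSchmidtCoeff Ω v i)) • gramSchmidtCoeff Ω v i) =
      v j - ∑ i ∈ Finset.Iio j, l2Inner Ω (v j) (etaField Ω q i) • etaField Ω q i := by
    rw [Finset.sum_coe_sort (Finset.Iio j) (fun i =>
      l2Inner Ω (v j) (combination v (gramSchmidtCoeff Ω v i)) • gramSchmidtCoeff Ω v i),
      hsub, hsingle, hsum]
    simp only [hsmul, hη]
  rw [hη j, gramSchmidtCoeff]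
  simp only [hsmul]
  rw [hr]

/-- The vector field `∑_{l,k} α_{kl} (∫_{Γ_l} b·ν dS) η_k` on `Ω`. -/
def harmonicPart {K : ℕ} (Ω : Set E3) (Γ : Fin (K + 1) → Set E3) (q : Fin K → E3 → ℝ)
    (b : E3 → E3) : E3 → E3 :=
  ∑ l : Fin K, ∑ k : Fin K, (alphaCoeff Ω q k l * flux Ω (Γ l.succ) b) • etaField Ω q k

/-- The constant `C_s = 3^{-1/2} 2^{2/3} π^{-2/3}`. -/
def sobolevConst : ℝ :=
  (3 : ℝ) ^ (-(1 / 2) : ℝ) * (2 : ℝ) ^ (2 / 3 : ℝ) * Real.pi ^ (-(2 / 3) : ℝ)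

/-- The smallness hypothesis of the existence theorem for time periodic solutions:
`sup_{0 ≤ t ≤ T} ‖∑_{l,k} α_{kl}(t) (∫_{Γ_l(t)} β(t)·ν(t) dS) η_k(t)‖_{L³(Ω(t))} < 1 / C_s`. -/
def SmallnessHypothesis {K : ℕ} (T : ℝ) (Ω : ℝ → Set E3) (Γ : ℝ → Fin (K + 1) → Set E3)
    (q : ℝ → Fin K → E3 → ℝ) (β : ℝ → E3 → E3) : Prop :=
  (⨆ t ∈ Icc (0 : ℝ) T,
      eLpNorm (harmonicPart (Ω t) (Γ t) (q t) (β t)) 3 (volume.restrict (Ω t))) <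
    ENNReal.ofReal (1 / sobolevConst)

end

/-! Everything is scaling. Write $c=\lambda(t)$. Pulling $q_k(t)$ back by $x\mapsto cx$ gives a
harmonic function on $\Omega(0)$ with the pulled-back boundary values, so by uniqueness for the
Dirichlet problem $\nabla q_k$ is $c^{-1}$ times a fixed field. An $L^2$ product of two gradients
thus scales like $c^3c^{-2}=c$, and the Gram–Schmidt coefficients like $c^{-1/2}$
(`gramSchmidtCoeff_image_smul`). Two coefficients and one gradient make the field of size $c^{-2}$
pointwise, and the volume contributes $c$ to the $L^3$ norm. Hence the norm is at most
$Mc^{-1}\sum_k|\text{flux}_k|$, as in `exists_eLpNorm_harmonicPart_le`.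

For $M$ to depend on $\Omega(0)$ only, the numbering of the boundary components must not matter,
although Gram–Schmidt depends on it. Pulled-back components agree with a fixed list up to a
permutation (`exists_equiv_of_iUnion_eq`), and there are finitely many permutations. -/

/-! ### Maximum principle, gradient bounds and dilation of derivatives. -/

section MaximumPrinciple

variable {E : Type*} [NormedAddCommGroup E] [InnerProductSpace ℝ E]

/-- The second derivative along a line, in terms of the second Fréchet derivative. -/
theorem deriv_deriv_comp_line {u : E → ℝ} {z : E} (hu : ContDiffAt ℝ 2 u z) (e : E) :
    (∀ᶠ s : ℝ in 𝓝 0, HasDerivAt (fun r : ℝ => u (z + r • e)) (fderiv ℝ u (z + s • e) e) s) ∧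
      HasDerivAt (fun s : ℝ => fderiv ℝ u (z + s • e) e) (iteratedFDeriv ℝ 2 u z ![e, e]) 0 := by
  have hline : ∀ s : ℝ, HasDerivAt (fun r : ℝ => z + r • e) e s := fun s => by
    simpa using ((hasDerivAt_id s).smul_const e).const_add z
  have htends : Tendsto (fun r : ℝ => z + r • e) (𝓝 0) (𝓝 z) := by
    simpa using (hline 0).continuousAt.tendsto
  constructor
  · filter_upwards [htends.eventually (hu.eventually (by simp))] with s hs
    have hs' : DifferentiableAt ℝ u (z + s • e) := hs.differentiableAt two_ne_zero
    exact HasFDerivAt.comp_hasDerivAt (f := fun r : ℝ => z + r • e) s hs'.hasFDerivAt (hline s)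
  · have h2 : DifferentiableAt ℝ (fderiv ℝ u) (z + (0 : ℝ) • e) := by
      simpa using (hu.fderiv_right (m := 1) (by norm_num)).differentiableAt (by norm_num)
    have h3 := (HasFDerivAt.comp_hasDerivAt (f := fun r : ℝ => z + r • e) (0 : ℝ)
      h2.hasFDerivAt (hline 0)).clm_apply
      (hasDerivAt_const (0 : ℝ) e)
    simpa [iteratedFDeriv_two_apply, Function.comp_def] using h3

/-- At a local maximum of `u + ε ‖x‖²` the second directional derivatives of `u` are negative. -/
theorem iteratedFDeriv_two_lt_zero_of_isLocalMax {u : E → ℝ} {z : E} (hu : ContDiffAt ℝ 2 u z)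
    {ε : ℝ} (hε : 0 < ε) (hmax : IsLocalMax (fun x => u x + ε * ‖x‖ ^ 2) z) {e : E}
    (he : ‖e‖ = 1) : iteratedFDeriv ℝ 2 u z ![e, e] < 0 := by
  -- Otherwise the term `2 * ε` makes the second derivative of the restriction `g` to the line
  -- positive. Its critical point is then both a local maximum and a local minimum, so `g` is
  -- locally constant, a contradiction.
  by_contra! hcon
  obtain ⟨h1, h2⟩ := deriv_deriv_comp_line hu e
  set g : ℝ → ℝ := fun s => u (z + s • e) + ε * ‖z + s • e‖ ^ 2 with hg
  have hnorm : ∀ s : ℝ, ‖z + s • e‖ ^ 2 = ‖z‖ ^ 2 + 2 * s * inner ℝ z e + s ^ 2 := fun s => by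
    rw [norm_add_sq_real, inner_smul_right, norm_smul, he, mul_one, Real.norm_eq_abs, sq_abs]
    ring
  have hq : ∀ s : ℝ, HasDerivAt (fun s : ℝ => ε * ‖z + s • e‖ ^ 2)
      (ε * (2 * inner ℝ z e + 2 * s)) s := fun s => by
    simp only [hnorm]
    refine HasDerivAt.const_mul ε ?_
    have := (((hasDerivAt_id s).const_mul 2).mul_const (inner ℝ z e)).const_add (‖z‖ ^ 2)
    exact (this.add (hasDerivAt_pow 2 s)).congr_deriv (by simp)
  have hg1 : ∀ᶠ s : ℝ in 𝓝 0,
      HasDerivAt g (fderiv ℝ u (z + s • e) e + ε * (2 * inner ℝ z e + 2 * s)) s := by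
    filter_upwards [h1] with s hs using hs.add (hq s)
  have hg1' : deriv g =ᶠ[𝓝 0]
      fun s => fderiv ℝ u (z + s • e) e + ε * (2 * inner ℝ z e + 2 * s) := by
    filter_upwards [hg1] with s hs using hs.deriv
  have hg2 : deriv (deriv g) 0 = iteratedFDeriv ℝ 2 u z ![e, e] + ε * 2 := by
    rw [hg1'.deriv_eq]
    refine (h2.add (HasDerivAt.const_mul ε ?_)).deriv
    simpa using ((hasDerivAt_id (0 : ℝ)).const_mul 2).const_add (2 * inner ℝ z e)
  have hpos : 0 < deriv (deriv g) 0 := by rw [hg2]; positivity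
  have htends : Tendsto (fun r : ℝ => z + r • e) (𝓝 0) (𝓝 z) := by
    have : Continuous fun r : ℝ => z + r • e := by fun_prop
    simpa using this.tendsto 0
  have hgmax : IsLocalMax g 0 := by
    filter_upwards [htends.eventually hmax] with s hs
    simpa [hg] using hs
  have hgmin : IsLocalMin g 0 := isLocalMin_of_deriv_deriv_pos hpos hgmax.deriv_eq_zero
    hg1.self_of_nhds.continuousAt
  have hconst : g =ᶠ[𝓝 0] fun _ => g 0 := by
    filter_upwards [hgmax, hgmin] with s h h' using le_antisymm h h'
  have : deriv (deriv g) 0 = 0 := by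
    rw [hconst.deriv.deriv_eq]
    simp
  exact hpos.ne' this

variable [FiniteDimensional ℝ E]

/-- The weak maximum principle for harmonic functions with vanishing boundary values. -/
theorem nonpos_of_laplacian_eq_zero [Nontrivial E] {Ω : Set E} (ho : IsOpen Ω)
    (hb : Bornology.IsBounded Ω) {u : E → ℝ} (hc : ContinuousOn u (closure Ω))
    (hu : ContDiffOn ℝ 2 u Ω) (hΔ : ∀ x ∈ Ω, Δ u x = 0) (h0 : ∀ x ∈ frontier Ω, u x = 0)
    {x : E} (hx : x ∈ Ω) : u x ≤ 0 := by
  by_contra! hpos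
  obtain ⟨R, hR⟩ := hb.closure.exists_norm_le
  -- With this `ε` the perturbed function is at most `ε * R ^ 2 < u x` on the frontier, so its
  -- maximum is interior.
  have hε : 0 < u x / (2 * (R ^ 2 + 1)) := by positivity
  set ε := u x / (2 * (R ^ 2 + 1)) with hε_def
  obtain ⟨z, hz, hzmax⟩ := hb.isCompact_closure.exists_isMaxOn ⟨x, subset_closure hx⟩
    (f := fun x => u x + ε * ‖x‖ ^ 2)
    (hc.add (by fun_prop))
  have hzx : u x + ε * ‖x‖ ^ 2 ≤ u z + ε * ‖z‖ ^ 2 := hzmax (subset_closure hx)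
  have hzΩ : z ∈ Ω := by
    by_contra hzn
    have hzf : z ∈ frontier Ω := ⟨hz, by rwa [ho.interior_eq]⟩
    rw [h0 z hzf] at hzx
    have hzR : ‖z‖ ^ 2 ≤ R ^ 2 := pow_le_pow_left₀ (norm_nonneg z) (hR z hz) 2
    have h1 : ε * (2 * (R ^ 2 + 1)) = u x := by
      rw [hε_def]; field_simp
    nlinarith [mul_le_mul_of_nonneg_left hzR hε.le, mul_nonneg hε.le (sq_nonneg ‖x‖)]
  have hloc : IsLocalMax (fun x => u x + ε * ‖x‖ ^ 2) z :=
    hzmax.isLocalMax (mem_of_superset (ho.mem_nhds hzΩ) subset_closure)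
  have hneg : ∀ e : E, ‖e‖ = 1 → iteratedFDeriv ℝ 2 u z ![e, e] < 0 := fun e he =>
    iteratedFDeriv_two_lt_zero_of_isLocalMax (hu.contDiffAt (ho.mem_nhds hzΩ)) hε hloc he
  have hsum := hΔ z hzΩ
  rw [InnerProductSpace.laplacian_eq_iteratedFDeriv_stdOrthonormalBasis] at hsum
  have : ∑ i, iteratedFDeriv ℝ 2 u z
      ![(stdOrthonormalBasis ℝ E) i, (stdOrthonormalBasis ℝ E) i] < 0 :=
    Finset.sum_neg (fun i _ => hneg _ ((stdOrthonormalBasis ℝ E).orthonormal.1 i))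
      ⟨⟨0, Module.finrank_pos⟩, Finset.mem_univ _⟩
  exact this.ne hsum

/-- Uniqueness for the Dirichlet problem. -/
theorem eqOn_of_laplacian_eq_zero [Nontrivial E] {Ω : Set E} (ho : IsOpen Ω)
    (hb : Bornology.IsBounded Ω) {u v : E → ℝ} (huc : ContinuousOn u (closure Ω))
    (hvc : ContinuousOn v (closure Ω)) (hu : ContDiffOn ℝ 2 u Ω) (hv : ContDiffOn ℝ 2 v Ω)
    (hΔu : ∀ x ∈ Ω, Δ u x = 0) (hΔv : ∀ x ∈ Ω, Δ v x = 0) (huv : EqOn u v (frontier Ω)) :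
    EqOn u v Ω := by
  have key : ∀ {u v : E → ℝ}, ContinuousOn u (closure Ω) → ContinuousOn v (closure Ω) →
      ContDiffOn ℝ 2 u Ω → ContDiffOn ℝ 2 v Ω → (∀ x ∈ Ω, Δ u x = 0) → (∀ x ∈ Ω, Δ v x = 0) →
      EqOn u v (frontier Ω) → ∀ x ∈ Ω, u x ≤ v x := by
    intro u v huc hvc hu hv hΔu hΔv huv x hx
    have := nonpos_of_laplacian_eq_zero ho hb (u := u - v) (huc.sub hvc) (hu.sub hv)
      (fun y hy => by
        rw [(hu.contDiffAt (ho.mem_nhds hy)).laplacian_sub (hv.contDiffAt (ho.mem_nhds hy)),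
          hΔu y hy, hΔv y hy, sub_zero])
      (fun y hy => sub_eq_zero.2 (huv hy)) hx
    simpa using this
  exact fun x hx => le_antisymm (key huc hvc hu hv hΔu hΔv huv x hx)
    (key hvc huc hv hu hΔv hΔu huv.symm x hx)

/-- A function which is `C¹` up to the boundary has bounded gradient. -/
theorem exists_norm_gradient_le {Ω : Set E} (ho : IsOpen Ω) (hb : Bornology.IsBounded Ω)
    {u : E → ℝ} (hu : ContDiffOn ℝ 1 u (closure Ω)) :
    ∃ B : ℝ, 0 ≤ B ∧ ∀ x ∈ Ω, ‖∇ u x‖ ≤ B := by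
  have hloc : ∀ x ∈ closure Ω, ∃ t ∈ 𝓝[closure Ω] x, ∃ B : ℝ, ∀ y ∈ t ∩ Ω, ‖∇ u y‖ ≤ B := by
    intro x hx
    -- Near `x` there is a derivative within the closure that is continuous at `x`, hence bounded
    -- nearby. At points of `Ω` it is the true derivative; compactness makes the bound global.
    have hux : ContDiffWithinAt ℝ (0 + 1) u (closure Ω) x := by simpa using hu x hx
    obtain ⟨w, hw, -, -, f', hf', hf'c⟩ := (contDiffWithinAt_succ_iff_hasFDerivWithinAt'
      (by simp)).1 hux
    rw [insert_eq_of_mem hx] at hw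
    obtain ⟨o, ho', hxo, how⟩ := mem_nhdsWithin.1 hw
    have hbound : ∀ᶠ y in 𝓝[closure Ω] x, ‖f' y‖ ≤ ‖f' x‖ + 1 :=
      hf'c.continuousWithinAt.norm.eventually_le_const (lt_add_one _)
    refine ⟨_, inter_mem hbound (inter_mem_nhdsWithin _ (ho'.mem_nhds hxo)), ‖f' x‖ + 1, ?_⟩
    rintro y ⟨⟨hy, hyc, hyo⟩, hyΩ⟩
    have hd := (hf' y (how ⟨hyo, hyc⟩)).hasFDerivAt
      (mem_of_superset (ho.mem_nhds hyΩ) subset_closure)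
    rw [gradient, LinearIsometryEquiv.norm_map, hd.fderiv]
    exact hy
  obtain ⟨B, hB⟩ := hb.isCompact_closure.induction_on
    (p := fun t => ∃ B : ℝ, ∀ y ∈ t ∩ Ω, ‖∇ u y‖ ≤ B) ⟨0, by simp⟩
    (fun s t hst ⟨B, hB⟩ => ⟨B, fun y hy => hB y ⟨hst hy.1, hy.2⟩⟩)
    (fun s t ⟨B, hB⟩ ⟨B', hB'⟩ => ⟨max B B', fun y hy => hy.1.elim
      (fun h => (hB y ⟨h, hy.2⟩).trans (le_max_left _ _))
      (fun h => (hB' y ⟨h, hy.2⟩).trans (le_max_right _ _))⟩) hloc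
  exact ⟨max B 0, le_max_right _ _, fun x hx =>
    (hB x ⟨subset_closure hx, hx⟩).trans (le_max_left _ _)⟩

/-- The Laplacian of a dilated function. -/
theorem laplacian_comp_smul (u : E → ℝ) (c : ℝ) (x : E) :
    Δ (fun y => u (c • y)) x = c ^ 2 * Δ u (c • x) := by
  have h : fderiv ℝ (fun y => u (c • y)) = fun y => c • fderiv ℝ u (c • y) :=
    funext fun y => fderiv_comp_smul c
  have h2 : fderiv ℝ (fderiv ℝ fun y => u (c • y)) x = c • c • fderiv ℝ (fderiv ℝ u) (c • x) := by
    rw [h]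
    have := congrFun (fderiv_const_smul_field (𝕜 := ℝ) (f := fun y => fderiv ℝ u (c • y)) c) x
    exact this.trans (congrArg (c • ·) (fderiv_comp_smul (f := fderiv ℝ u) c))
  simp only [InnerProductSpace.laplacian_eq_iteratedFDeriv_stdOrthonormalBasis,
    iteratedFDeriv_two_apply, h2, Finset.mul_sum]
  simp [pow_two, mul_assoc]

/-- The gradient of a dilated function. -/
theorem gradient_comp_smul (u : E → ℝ) (c : ℝ) (x : E) :
    ∇ (fun y => u (c • y)) x = c • ∇ u (c • x) := by
  simp [gradient, fderiv_comp_smul]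

end MaximumPrinciple

/-! ### Uniqueness of finite partitions into closed connected sets. -/

section Partition

/-- A preconnected set covered by finitely many disjoint closed sets lies in any one of them which
it meets. -/
theorem IsPreconnected.subset_of_mem_of_subset_iUnion {X κ : Type*} [TopologicalSpace X] [Finite κ]
    {s : Set X} {B : κ → Set X} (hs : IsPreconnected s) (hB : ∀ k, IsClosed (B k))
    (hBd : ∀ k l, k ≠ l → Disjoint (B k) (B l)) (hsB : s ⊆ ⋃ k, B k) {k : κ} {x : X} (hx : x ∈ s)
    (hxk : x ∈ B k) : s ⊆ B k := by
  by_contra hn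
  obtain ⟨y, hy, hyk⟩ := not_subset.1 hn
  obtain ⟨l, hl⟩ := mem_iUnion.1 (hsB hy)
  have hlk : l ≠ k := fun h => hyk (h ▸ hl)
  -- Finiteness makes the union of the other pieces closed, so `B k` and this union would disconnect
  -- `s`.
  have hcl : IsClosed (⋃ m : {m // m ≠ k}, B m) := isClosed_iUnion_of_finite fun m => hB m
  obtain ⟨z, -, hzk, hz⟩ := isPreconnected_closed_iff.1 hs _ _ (hB k) hcl
    (fun z hz => by
      obtain ⟨m, hm⟩ := mem_iUnion.1 (hsB hz)
      by_cases h : m = k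
      · exact Or.inl (h ▸ hm)
      · exact Or.inr (mem_iUnion.2 ⟨⟨m, h⟩, hm⟩))
    ⟨x, hx, hxk⟩ ⟨y, hy, mem_iUnion.2 ⟨⟨l, hlk⟩, hl⟩⟩
  obtain ⟨m, hm⟩ := mem_iUnion.1 hz
  exact (hBd _ _ m.2).le_bot ⟨hm, hzk⟩

/-- A connected member of one family is contained in a member of a finite family of disjoint closed
sets with larger union. -/
theorem exists_subset_of_iUnion_subset {X ι κ : Type*} [TopologicalSpace X] [Finite κ]
    {A : ι → Set X} {B : κ → Set X} (hB : ∀ k, IsClosed (B k)) (hA : ∀ i, IsConnected (A i))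
    (hBd : ∀ k l, k ≠ l → Disjoint (B k) (B l)) (hAB : ⋃ i, A i ⊆ ⋃ k, B k) (i : ι) :
    ∃ k, A i ⊆ B k := by
  obtain ⟨x, hx⟩ := (hA i).nonempty
  have hi := (subset_iUnion A i).trans hAB
  obtain ⟨k, hk⟩ := mem_iUnion.1 (hi hx)
  exact ⟨k, (hA i).isPreconnected.subset_of_mem_of_subset_iUnion hB hBd hi hx hk⟩

theorem eq_of_subset_of_disjoint {X ι : Type*} {A : ι → Set X} (hA : ∀ i, (A i).Nonempty)
    (hAd : ∀ i j, i ≠ j → Disjoint (A i) (A j)) {i j : ι} (hij : A i ⊆ A j) : i = j := by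
  by_contra hne
  obtain ⟨x, hx⟩ := hA i
  exact (hAd i j hne).le_bot ⟨hx, hij hx⟩

/-- Two finite partitions of a set into disjoint closed connected sets agree up to relabelling. -/
theorem exists_equiv_of_iUnion_eq {X ι κ : Type*} [TopologicalSpace X] [Finite ι] [Finite κ]
    {A : ι → Set X} {B : κ → Set X} (hA : ∀ i, IsClosed (A i)) (hB : ∀ k, IsClosed (B k))
    (hAc : ∀ i, IsConnected (A i)) (hBc : ∀ k, IsConnected (B k))
    (hAd : ∀ i j, i ≠ j → Disjoint (A i) (A j)) (hBd : ∀ k l, k ≠ l → Disjoint (B k) (B l))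
    (hAB : ⋃ i, A i = ⋃ k, B k) : ∃ e : ι ≃ κ, ∀ i, A i = B (e i) := by
  choose f hf using exists_subset_of_iUnion_subset hB hAc hBd hAB.le
  choose g hg using exists_subset_of_iUnion_subset hA hBc hAd hAB.ge
  have hgf : ∀ i, g (f i) = i := fun i => (eq_of_subset_of_disjoint (fun i => (hAc i).nonempty) hAd ((hf i).trans (hg _))).symm
  have hfg : ∀ k, f (g k) = k := fun k => (eq_of_subset_of_disjoint (fun k => (hBc k).nonempty) hBd ((hg k).trans (hf _))).symm
  refine ⟨⟨f, g, hgf, hfg⟩, fun i => (hf i).antisymm ?_⟩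
  simpa [hgf] using hg (f i)

end Partition

/-! ### Scaling of potentials, Gram–Schmidt coefficients and the $L^3$ norm. -/

section Dilation

/-- The `L²` inner product of dilated vector fields. -/
theorem l2Inner_image_smul {Ω : Set E3} (hΩ : MeasurableSet Ω) {c s r : ℝ} (hc : 0 < c)
    {f g f₀ g₀ : E3 → E3} (hf : ∀ y ∈ Ω, f (c • y) = s • f₀ y)
    (hg : ∀ y ∈ Ω, g (c • y) = r • g₀ y) :
    l2Inner ((fun x => c • x) '' Ω) f g = c ^ 3 * (s * r) * l2Inner Ω f₀ g₀ := by
  have h := Measure.setIntegral_comp_smul_of_pos (volume : Measure E3)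
    (fun x => inner ℝ (f x) (g x)) Ω hc
  have h' : ∫ x in Ω, inner ℝ (f (c • x)) (g (c • x)) = s * r * l2Inner Ω f₀ g₀ := by
    rw [l2Inner, ← integral_const_mul]
    refine setIntegral_congr_fun hΩ fun x hx => ?_
    simp only [hf x hx, hg x hx, inner_smul_left, inner_smul_right, conj_trivial]
    ring
  rw [h', finrank_euclideanSpace_fin, smul_eq_mul] at h
  rw [l2Inner, image_smul, mul_assoc, h]
  field_simp

theorem combination_smul {K : ℕ} (v : Fin K → E3 → E3) (s : ℝ) (a : Fin K → ℝ) :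
    combination v (s • a) = s • combination v a := by
  simp [combination, Finset.smul_sum, smul_smul]

theorem combination_image_smul {K : ℕ} {v w : Fin K → E3 → E3} {Ω : Set E3} {c s : ℝ}
    (h : ∀ k, ∀ y ∈ Ω, v k (c • y) = s • w k y) (a : Fin K → ℝ) :
    ∀ y ∈ Ω, combination v a (c • y) = s • combination w a y := by
  intro y hy
  simp only [combination, Finset.sum_apply, Pi.smul_apply, Finset.smul_sum, h _ y hy]
  exact Finset.sum_congr rfl fun k _ => smul_comm _ _ _

/-- The Gram-Schmidt coefficients of the gradients of dilated functions. -/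
theorem gramSchmidtCoeff_image_smul {K : ℕ} {Ω : Set E3} (hΩ : MeasurableSet Ω) {c : ℝ}
    (hc : 0 < c) {v w : Fin K → E3 → E3} (h : ∀ k, ∀ y ∈ Ω, v k (c • y) = c⁻¹ • w k y)
    (j : Fin K) :
    gramSchmidtCoeff ((fun x => c • x) '' Ω) v j = (√c)⁻¹ • gramSchmidtCoeff Ω w j := by
  induction j using WellFoundedLT.induction with
  | ind j ih =>
  have hs : √c ≠ 0 := (Real.sqrt_pos.2 hc).ne'
  have hs2 : √c * √c = c := Real.mul_self_sqrt hc.le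
  -- The unnormalized coefficients are scale invariant: the inner product scales by $c^3\cdot
  -- c^{-1}\cdot c^{-3/2}$ and the earlier coefficients, by induction, by $c^{-1/2}$.
  have hr : (Pi.single j 1 - ∑ i : Finset.Iio j,
        l2Inner ((fun x => c • x) '' Ω) (v j)
          (combination v (gramSchmidtCoeff ((fun x => c • x) '' Ω) v i)) •
        gramSchmidtCoeff ((fun x => c • x) '' Ω) v i : Fin K → ℝ) =
      Pi.single j 1 - ∑ i : Finset.Iio j,
        l2Inner Ω (w j) (combination w (gramSchmidtCoeff Ω w i)) • gramSchmidtCoeff Ω w i := by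
    congr 1
    refine Finset.sum_congr rfl fun i _ => ?_
    rw [ih i (Finset.mem_Iio.1 i.2), combination_smul,
      l2Inner_image_smul hΩ hc (h j) (r := (√c)⁻¹ * c⁻¹)
        (g₀ := combination w (gramSchmidtCoeff Ω w i)) (fun y hy => by
          rw [Pi.smul_apply, combination_image_smul h _ y hy, smul_smul]), smul_smul]
    congr 1
    have : c ^ 3 * (c⁻¹ * ((√c)⁻¹ * c⁻¹)) * (√c)⁻¹ = 1 := by
      field_simp
      rw [pow_two, hs2]
    calc _ = c ^ 3 * (c⁻¹ * ((√c)⁻¹ * c⁻¹)) * (√c)⁻¹ *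
          l2Inner Ω (w j) (combination w (gramSchmidtCoeff Ω w i)) := by ring
      _ = _ := by rw [this, one_mul]
  rw [gramSchmidtCoeff, gramSchmidtCoeff]
  simp only [hr]
  rw [smul_smul]
  congr 1
  -- Only the normalization sees `c`: the squared norm scales by `c`. A vanishing norm does no harm,
  -- since the inverse of zero is zero on both sides.
  have hk := combination_image_smul h
  rw [l2Norm, l2Norm, l2Inner_image_smul hΩ hc (hk _) (hk _),
    show c ^ 3 * (c⁻¹ * c⁻¹) = c by field_simp, Real.sqrt_mul hc.le, mul_inv]

/-- A harmonic potential on a dilated domain gives one on the domain itself. -/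
theorem IsHarmonicPotential.comp_smul {K : ℕ} {Ω : Set E3} {Γ : Fin (K + 1) → Set E3} {k : Fin K}
    {q : E3 → ℝ} {c : ℝ}
    (hq : IsHarmonicPotential ((fun x => c • x) '' Ω) Γ k q) :
    IsHarmonicPotential Ω (fun j => (fun x => c • x) ⁻¹' Γ j) k (fun x => q (c • x)) where
  smooth := by
    refine hq.smooth.comp (contDiff_const_smul c).contDiffOn fun x hx => ?_
    exact image_closure_subset_closure_image (continuous_const_smul c) (mem_image_of_mem _ hx)
  harmonic := fun x hx => by
    rw [laplacian_comp_smul, hq.harmonic _ (mem_image_of_mem _ hx), mul_zero]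
  boundary := fun j x hx => hq.boundary j _ hx

/-- The harmonic potentials are unique. -/
theorem IsHarmonicPotential.eqOn {K : ℕ} {Ω : Set E3} {Γ : Fin (K + 1) → Set E3} {k : Fin K}
    {q p : E3 → ℝ} (ho : IsOpen Ω) (hb : Bornology.IsBounded Ω) (hΓ : ⋃ j, Γ j = frontier Ω)
    (hq : IsHarmonicPotential Ω Γ k q) (hp : IsHarmonicPotential Ω Γ k p) : EqOn q p Ω := by
  have hle : (2 : WithTop ℕ∞) ≤ ∞ := ENat.LEInfty.out
  refine eqOn_of_laplacian_eq_zero ho hb hq.smooth.continuousOn hp.smooth.continuousOn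
    ((hq.smooth.mono subset_closure).of_le hle) ((hp.smooth.mono subset_closure).of_le hle)
    hq.harmonic hp.harmonic fun x hx => ?_
  rw [← hΓ] at hx
  obtain ⟨j, hj⟩ := mem_iUnion.1 hx
  rw [hq.boundary j x hj, hp.boundary j x hj]

/-- Separates the fluxes `f` from a constant that involves only the reference coefficients and the
gradient bound. -/
theorem norm_sum_sum_smul_sum_le {ι F : Type*} [Fintype ι] [SeminormedAddCommGroup F]
    [NormedSpace ℝ F] (a : ι → ι → ℝ) (f : ι → ℝ) (v : ι → F) {B : ℝ} (hB : 0 ≤ B)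
    (hv : ∀ m, ‖v m‖ ≤ B) :
    ‖∑ l, ∑ k, (a k l * f l) • ∑ m, a k m • v m‖ ≤
      (∑ l, ∑ k, |a k l| * ∑ m, |a k m| * B) * ∑ l, |f l| := by
  rw [Finset.mul_sum]
  refine norm_sum_le_of_le _ fun l _ => ?_
  calc ‖∑ k, (a k l * f l) • ∑ m, a k m • v m‖
      ≤ ∑ k, |a k l| * (∑ m, |a k m| * B) * |f l| := by
        refine norm_sum_le_of_le _ fun k _ => ?_
        rw [norm_smul, Real.norm_eq_abs, abs_mul, mul_right_comm]
        gcongr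
        refine norm_sum_le_of_le _ fun m _ => ?_
        rw [norm_smul, Real.norm_eq_abs]
        gcongr
        exact hv m
    _ = (∑ k, |a k l| * ∑ m, |a k m| * B) * |f l| := by rw [Finset.sum_mul]
    _ ≤ _ := by
        refine mul_le_mul_of_nonneg_right ?_ (abs_nonneg _)
        exact Finset.single_le_sum (f := fun l => ∑ k, |a k l| * ∑ m, |a k m| * B)
          (fun l _ => by positivity) (Finset.mem_univ l)

/-- The bound for `harmonicPart` on the dilations of a domain with labelled boundary. -/
theorem exists_eLpNorm_harmonicPart_le {K : ℕ} {Ω : Set E3} (ho : IsOpen Ω)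
    (hb : Bornology.IsBounded Ω) {Γ₀ : Fin (K + 1) → Set E3} (hΓ₀ : ⋃ j, Γ₀ j = frontier Ω) :
    ∃ M : ℝ, ∀ (c : ℝ) (Γ : Fin (K + 1) → Set E3) (q : Fin K → E3 → ℝ)
      (b : E3 → E3), 0 < c → (∀ j, (fun x => c • x) ⁻¹' Γ j = Γ₀ j) →
      (∀ k, IsHarmonicPotential ((fun x => c • x) '' Ω) Γ k (q k)) →
      eLpNorm (harmonicPart ((fun x => c • x) '' Ω) Γ q b) 3
          (volume.restrict ((fun x => c • x) '' Ω)) ≤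
        ENNReal.ofReal (M * (c⁻¹ * ∑ k : Fin K,
          |flux ((fun x => c • x) '' Ω) (Γ k.succ) b|)) := by
  -- Solvability of the Dirichlet problem is not needed: potentials on any dilate pull back to `Ω`,
  -- so without reference potentials the claim is vacuous.
  by_cases hex : ∃ p : Fin K → E3 → ℝ, ∀ k, IsHarmonicPotential Ω Γ₀ k (p k)
  swap
  · refine ⟨0, fun c Γ q b hc hΓ hq => absurd ⟨fun k x => q k (c • x), fun k => ?_⟩ hex⟩
    simpa only [hΓ] using (hq k).comp_smul
  obtain ⟨p, hp⟩ := hex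
  have hbound : ∀ k, ∃ B : ℝ, 0 ≤ B ∧ ∀ x ∈ Ω, ‖∇ (p k) x‖ ≤ B := fun k =>
    exists_norm_gradient_le ho hb ((hp k).smooth.of_le (by exact_mod_cast le_top))
  choose B hB0 hB using hbound
  set a := alphaCoeff Ω p with ha
  set A : ℝ := ∑ l, ∑ k, |a k l| * ∑ m, |a k m| * ∑ k, B k with hA
  have hA0 : 0 ≤ ∑ k, B k := Finset.sum_nonneg fun k _ => hB0 k
  refine ⟨(volume.real Ω) ^ (3 : ℝ)⁻¹ * A, fun c Γ q b hc hΓ hq => ?_⟩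
  set F : Fin K → ℝ := fun l => flux ((fun x => c • x) '' Ω) (Γ l.succ) b with hF
  have hgrad : ∀ k, ∀ y ∈ Ω, ∇ (q k) (c • y) = c⁻¹ • ∇ (p k) y := by
    intro k y hy
    have h1 : IsHarmonicPotential Ω Γ₀ k (fun x => q k (c • x)) := by
      simpa only [hΓ] using (hq k).comp_smul
    have h2 := ((h1.eqOn ho hb hΓ₀ (hp k)).eventuallyEq_of_mem (ho.mem_nhds hy)).gradient_eq
    rw [← h2, gradient_comp_smul, smul_smul, inv_mul_cancel₀ hc.ne', one_smul]
  have hα : ∀ j k, alphaCoeff ((fun x => c • x) '' Ω) q j k = (√c)⁻¹ * a j k := fun j k =>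
    congrFun (gramSchmidtCoeff_image_smul ho.measurableSet hc hgrad j) k
  have hpt : ∀ y ∈ Ω, ‖harmonicPart ((fun x => c • x) '' Ω) Γ q b (c • y)‖ ≤
      c⁻¹ ^ 2 * (A * ∑ l, |F l|) := by
    intro y hy
    -- The factor $c^{-2}$ is $c^{-1/2}$ from each of the two coefficients times $c^{-1}$ from the
    -- gradient.
    have hval : harmonicPart ((fun x => c • x) '' Ω) Γ q b (c • y) =
        c⁻¹ ^ 2 • ∑ l, ∑ k, (a k l * F l) • ∑ m, a k m • ∇ (p m) y := by
      simp only [harmonicPart, etaField, Finset.sum_apply, Pi.smul_apply, hα, hgrad _ y hy,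
        Finset.smul_sum, smul_smul]
      refine Finset.sum_congr rfl fun l _ => Finset.sum_congr rfl fun k _ =>
        Finset.sum_congr rfl fun m _ => ?_
      congr 1
      have hs : (√c)⁻¹ * (√c)⁻¹ = c⁻¹ := by rw [← mul_inv, Real.mul_self_sqrt hc.le]
      calc _ = (√c)⁻¹ * (√c)⁻¹ * c⁻¹ * (a k l * F l * a k m) := by ring
        _ = _ := by rw [hs]; ring
    rw [hval, norm_smul, Real.norm_of_nonneg (by positivity)]
    gcongr
    exact norm_sum_sum_smul_sum_le a F _ hA0 fun m => (hB m y hy).trans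
      (Finset.single_le_sum (fun k _ => hB0 k) (Finset.mem_univ m))
  have hcΩ : MeasurableSet ((fun x => c • x) '' Ω) :=
    ((Homeomorph.smulOfNeZero c hc.ne').isOpenMap _ ho).measurableSet
  have hvol : volume.real ((fun x : E3 => c • x) '' Ω) = c ^ 3 * volume.real Ω := by
    rw [Measure.real, image_smul, Measure.addHaar_smul, finrank_euclideanSpace_fin,
      abs_of_pos (pow_pos hc 3), ENNReal.toReal_mul, ENNReal.toReal_ofReal (by positivity)]
    rfl
  have hfin : volume ((fun x : E3 => c • x) '' Ω) ≠ ⊤ := by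
    rw [image_smul]
    exact (hb.smul₀ c).measure_lt_top.ne
  -- The cube root of the volume supplies one factor `c`, turning $c^{-2}$ into $c^{-1}$.
  refine (eLpNorm_le_of_ae_bound (C := c⁻¹ ^ 2 * (A * ∑ l, |F l|))
    ((ae_restrict_iff' hcΩ).2 (ae_of_all _ ?_))).trans_eq ?_
  · rintro _ ⟨y, hy, rfl⟩
    exact hpt y hy
  · have hc3 : (c ^ 3) ^ (3 : ℝ)⁻¹ = c := by
      have := Real.pow_rpow_inv_natCast hc.le (n := 3) (by norm_num)
      simpa using this
    rw [Measure.restrict_apply_univ, ← ofReal_measureReal hfin, ENNReal.toReal_ofNat,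
      ENNReal.ofReal_rpow_of_nonneg measureReal_nonneg (by norm_num),
      ← ENNReal.ofReal_mul (by positivity), hvol,
      Real.mul_rpow (by positivity) measureReal_nonneg, hc3]
    congr 1
    rw [hF]
    field_simp

end Dilation

/-! ### Uniformity over labellings and the smallness condition. -/

theorem sobolevConst_pos : 0 < sobolevConst := by
  unfold sobolevConst
  positivity

/-- The bound for `harmonicPart`, uniformly over all labellings of the boundary of the domain. -/
theorem exists_eLpNorm_harmonicPart_le_of_labelling {Ω : Set E3} (ho : IsOpen Ω)
    (hb : Bornology.IsBounded Ω) :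
    ∃ M : ℝ, 0 ≤ M ∧ ∀ (K : ℕ) (c : ℝ) (Γ : Fin (K + 1) → Set E3) (q : Fin K → E3 → ℝ)
      (b : E3 → E3), 0 < c → IsBoundaryLabelling ((fun x => c • x) '' Ω) Γ →
      (∀ k, IsHarmonicPotential ((fun x => c • x) '' Ω) Γ k (q k)) →
      eLpNorm (harmonicPart ((fun x => c • x) '' Ω) Γ q b) 3
          (volume.restrict ((fun x => c • x) '' Ω)) ≤
        ENNReal.ofReal (M * (c⁻¹ * ∑ k : Fin K,
          |flux ((fun x => c • x) '' Ω) (Γ k.succ) b|)) := by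
  by_cases hex : ∃ (K : ℕ) (c : ℝ) (Γ : Fin (K + 1) → Set E3), 0 < c ∧
    IsBoundaryLabelling ((fun x => c • x) '' Ω) Γ
  swap
  · exact ⟨0, le_rfl, fun K c Γ q b hc hΓ => absurd ⟨K, c, Γ, hc, hΓ⟩ hex⟩
  have hpre : ∀ {K : ℕ} {c : ℝ} {Γ : Fin (K + 1) → Set E3} (hc : 0 < c),
      IsBoundaryLabelling ((fun x => c • x) '' Ω) Γ →
      (∀ j, IsClosed ((fun x => c • x) ⁻¹' Γ j)) ∧ (∀ j, IsConnected ((fun x => c • x) ⁻¹' Γ j)) ∧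
      (∀ k l, k ≠ l → Disjoint ((fun x => c • x) ⁻¹' Γ k) ((fun x => c • x) ⁻¹' Γ l)) ∧
      ⋃ j, (fun x => c • x) ⁻¹' Γ j = frontier Ω := by
    intro K c Γ hc hΓ
    set e : E3 ≃ₜ E3 := Homeomorph.smulOfNeZero c hc.ne' with he
    refine ⟨fun j => (hΓ.isClosed j).preimage e.continuous,
      fun j => e.isConnected_preimage.2 (hΓ.isConnected j),
      fun k l hkl => (hΓ.disjoint k l hkl).preimage _, ?_⟩
    rw [← preimage_iUnion, hΓ.iUnion_eq]
    change e ⁻¹' frontier (e '' Ω) = _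
    rw [e.preimage_frontier, e.preimage_image]
  obtain ⟨K₀, c₀, Γ₀, hc₀, hΓ₀⟩ := hex
  -- One labelling, pulled back to `Ω`, serves as reference; every other one is a permutation of it,
  -- which also forces `K = K₀`. Summing the constants over all permutations covers every case.
  obtain ⟨h₀cl, h₀con, h₀d, h₀U⟩ := hpre hc₀ hΓ₀
  have hperm : ∀ σ : Fin (K₀ + 1) ≃ Fin (K₀ + 1),
      ⋃ j, (fun x => c₀ • x) ⁻¹' Γ₀ (σ j) = frontier Ω := fun σ => by
    rw [← h₀U]
    exact σ.surjective.iUnion_comp (fun j => (fun x => c₀ • x) ⁻¹' Γ₀ j)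
  choose M hM using fun σ => exists_eLpNorm_harmonicPart_le ho hb (hperm σ)
  refine ⟨∑ σ, |M σ|, Finset.sum_nonneg fun σ _ => abs_nonneg _, fun K c Γ q b hc hΓ hq => ?_⟩
  obtain ⟨hcl, hcon, hd, hU⟩ := hpre hc hΓ
  obtain ⟨σ, hσ⟩ := exists_equiv_of_iUnion_eq hcl h₀cl hcon h₀con hd h₀d (hU.trans h₀U.symm)
  obtain rfl : K = K₀ := by simpa using Fintype.card_congr σ
  refine (hM σ c Γ q b hc hσ hq).trans (ENNReal.ofReal_le_ofReal ?_)
  gcongr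
  exact (le_abs_self _).trans
    (Finset.single_le_sum (f := fun σ => |M σ|) (fun σ _ => abs_nonneg _) (Finset.mem_univ σ))

theorem mainTheorem9 (Ω₀ : Set E3) :
    ∃ C₀ : ℝ, 0 < C₀ ∧
      ∀ (T : ℝ) (K : ℕ) (Ω : ℝ → Set E3) (Γ : ℝ → Fin (K + 1) → Set E3)
        (Ω' : Set E3) (φ ψ : E3 × ℝ → E3) (lam : ℝ → ℝ) (q : ℝ → Fin K → E3 → ℝ)
        (β : ℝ → E3 → E3),
        0 < T →
        -- the family of domains, and the periodicity of the diffeomorphism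
        IsAdmissibleFamily Ω Γ Ω' φ ψ →
        (∀ t, ∀ y ∈ closure Ω', ψ (y, t + T) = ψ (y, t)) →
        -- the dilation
        Ω 0 = Ω₀ →
        ContDiff ℝ ∞ lam →
        (∀ t, 0 < lam t) →
        (∀ t, lam (t + T) = lam t) →
        (∀ t, Ω t = (fun x => lam t • x) '' Ω 0) →
        -- `q_1(t), …, q_K(t)` are the solutions of the Dirichlet problems on `Ω(t)`
        (∀ t k, IsHarmonicPotential (Ω t) (Γ t) k (q t k)) →
        -- the boundary data
        (∀ t, MemHHalf (frontier (Ω t)) (β t)) →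
        (∀ t, flux (Ω t) (frontier (Ω t)) (β t) = 0) →
        IsC1HHalf (frontier Ω') (transformField Ω φ ψ β) →
        (∀ t, β (t + T) =ᵐ[surfaceMeasure.restrict (frontier (Ω t))] β t) →
        (∀ t ∈ Icc (0 : ℝ) T,
          (lam t)⁻¹ * ∑ k : Fin K, |flux (Ω t) (Γ t k.succ) (β t)| < C₀) →
        SmallnessHypothesis T Ω Γ q β := by
  -- If `Ω₀` is not open and bounded, no admissible family starts from it and any constant works.
  by_cases hΩ₀ : IsOpen Ω₀ ∧ Bornology.IsBounded Ω₀
  swap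
  · refine ⟨1, one_pos, ?_⟩
    rintro T K Ω Γ Ω' φ ψ lam q β - hfam - rfl
    exact absurd ⟨(hfam.domain 0).isOpen, (hfam.domain 0).isBounded⟩ hΩ₀
  obtain ⟨M, hM0, hM⟩ := exists_eLpNorm_harmonicPart_le_of_labelling hΩ₀.1 hΩ₀.2
  have hS := sobolevConst_pos
  -- The factor 2 leaves a margin uniform in `t`, so the supremum stays strictly below the
  -- threshold; `M + 1` avoids dividing by zero.
  refine ⟨1 / sobolevConst / (2 * (M + 1)), by positivity, ?_⟩
  rintro T K Ω Γ Ω' φ ψ lam q β - hfam - rfl - hlam - hdil hq - - - - hsmall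
  have hlt : ENNReal.ofReal (1 / sobolevConst / 2) < ENNReal.ofReal (1 / sobolevConst) :=
    (ENNReal.ofReal_lt_ofReal_iff (by positivity)).2 (half_lt_self (by positivity))
  refine lt_of_le_of_lt (iSup₂_le fun t ht => ?_) hlt
  have hlab := hfam.boundary t
  have hqt := hq t
  have hst := hsmall t ht
  rw [hdil t] at hlab hqt hst ⊢
  refine (hM K (lam t) (Γ t) (q t) (β t) (hlam t) hlab hqt).trans (ENNReal.ofReal_le_ofReal ?_)
  have hlam' := hlam t
  calc M * _ ≤ (M + 1) * (1 / sobolevConst / (2 * (M + 1))) :=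
        mul_le_mul (by linarith) hst.le (by positivity) (by positivity)
    _ = 1 / sobolevConst / 2 := by field_simp
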